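/- Let $E$ be a Euclidean space, i.e. a finite-dimensional real inner product space (for instance $E=\mathbb R^d$), with its Borel $\sigma$-algebra, let $e\in E$ with $|e|=1$, and let $\rho_0=\tfrac12(\delta_{-e}+\delta_{e})$ (for $E=\mathbb R$ and $e=1$ this is $\tfrac12(\delta_{-1}+\delta_1)$). Let $\mathcal H^1$ be the one-dimensional Hausdorff measure, $[a,b]$ the closed segment between $a,b\in E$, $\mathcal P_2(E)$ the set of Borel probability measures on $E$ with finite second moment, and $W_2$ the $2$-Wasserstein distance. For $\nu\in\mathcal P_2(E)$ let $$\mathcal L(\nu)=\begin{cases}\min\{\alpha\ge 0:\ \alpha\,\nu\ \ge\ \mathcal H^1\llcorner\operatorname{supp}\nu\}&\text{if }\operatorname{supp}\nu\text{ is connected},\\ +\infty&\text{otherwise,}\end{cases}\qquad \min\emptyset=+\infty .$$ Then for every $\Lambda>0$ the relaxed problem $$\inf_{\nu\in\mathcal P_2(E)}\ W_2^2(\rho_0,\nu)+\Lambda\,\mathcal L(\nu)$$ has exactly one minimizer, namely $$\nu_\Lambda=\begin{cases}\sqrt{\tfrac{3\Lambda}{2}}\;\mathcal H^1\llcorner[-e,e]+\Big(\tfrac12-\sqrt{\tfrac{3\Lambda}{2}}\Big)(\delta_{-e}+\delta_{e})&\text{if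 }0<\Lambda<\tfrac16,\\[4pt] \dfrac{1}{3(1-2\Lambda)}\;\mathcal H^1\llcorner\big[-\tfrac32(1-2\Lambda)\,e,\ \tfrac32(1-2\Lambda)\,e\big]&\text{if }\tfrac16\le\Lambda<\tfrac12,\\[4pt] \delta_0&\text{if }\Lambda\ge\tfrac12 .\end{cases}$$ -/

import Mathlib

open MeasureTheory
open scoped ENNReal NNReal

noncomputable section

namespace LengthRelaxation

variable {X : Type*} [MetricSpace X] [MeasurableSpace X]

/-- `γ` is a transport plan between `ρ` and `ν`: a measure on the product whose first and second
marginals are `ρ` and `ν`. -/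
def IsTransportPlan (ρ ν : Measure X) (γ : Measure (X × X)) : Prop :=
  γ.map Prod.fst = ρ ∧ γ.map Prod.snd = ν

/-- The `p`-Wasserstein distance
`W_p(ρ, ν) = (inf_γ ∫ |x - y|^p dγ(x, y))^(1/p)`, the infimum being over all transport plans. -/
def wasserstein (p : ℝ) (ρ ν : Measure X) : ℝ≥0∞ :=
  (⨅ (γ : Measure (X × X)) (_ : IsTransportPlan ρ ν γ), ∫⁻ z, edist z.1 z.2 ^ p ∂γ) ^ (1 / p)

variable [BorelSpace X]

open Classical in
/-- The length functional: the least `α ≥ 0` (finite) such that `α ν ≥ ℋ¹ ⌞ supp ν`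
if `supp ν` is connected, with value `∞` if there is no such `α` or if `supp ν` is not
connected. -/
def lengthFunctional (ν : Measure X) : ℝ≥0∞ :=
  if IsConnected ν.support then
    ⨅ (α : ℝ≥0) (_ : (Measure.hausdorffMeasure 1 : Measure X).restrict ν.support ≤ α • ν),
      (α : ℝ≥0∞)
  else ∞

/-- The relaxed energy `W_p^p(ρ₀, ν) + Λ 𝓛(ν)`. -/
def relaxedEnergy (p Λ : ℝ) (ρ₀ ν : Measure X) : ℝ≥0∞ :=
  wasserstein p ρ₀ ν ^ p + ENNReal.ofReal Λ * lengthFunctional ν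

variable {E : Type*} [NormedAddCommGroup E] [MeasurableSpace E]

/-- The space `𝒫_p(E)` of Borel probability measures with finite `p`-th moment. -/
def finiteMomentProbability (E : Type*) [NormedAddCommGroup E] [MeasurableSpace E] (p : ℝ) :
    Set (Measure E) :=
  {ν | IsProbabilityMeasure ν ∧ ∫⁻ x, ‖x‖ₑ ^ p ∂ν < ∞}

/-- `ν` is a solution of the relaxed problem: it belongs to `𝒫_p(E)` and minimizes the relaxed
energy over `𝒫_p(E)`. -/
def IsRelaxedSolution [BorelSpace E] (p Λ : ℝ) (ρ₀ ν : Measure E) : Prop :=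
  ν ∈ finiteMomentProbability E p ∧
    ∀ μ ∈ finiteMomentProbability E p, relaxedEnergy p Λ ρ₀ ν ≤ relaxedEnergy p Λ ρ₀ μ

/-- The datum `½ (δ_{-e} + δ_e)`. -/
def twoDiracs (e : E) : Measure E :=
  (2⁻¹ : ℝ≥0∞) • (Measure.dirac (-e) + Measure.dirac e)

/-- The explicit measure `ν_Λ` on the line through `0` and `e`. -/
def explicitMinimizer [InnerProductSpace ℝ E] [BorelSpace E] (e : E) (Λ : ℝ) : Measure E :=
  if Λ < 1 / 6 then
    ENNReal.ofReal (√(3 * Λ / 2)) •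
        (Measure.hausdorffMeasure 1 : Measure E).restrict (segment ℝ (-e) e) +
      ENNReal.ofReal (1 / 2 - √(3 * Λ / 2)) • (Measure.dirac (-e) + Measure.dirac e)
  else if Λ < 1 / 2 then
    ENNReal.ofReal (1 / (3 * (1 - 2 * Λ))) •
      (Measure.hausdorffMeasure 1 : Measure E).restrict
        (segment ℝ (-((3 / 2 * (1 - 2 * Λ)) • e)) ((3 / 2 * (1 - 2 * Λ)) • e))
  else Measure.dirac 0

end LengthRelaxation

end

/-! Everything reduces to one real parameter, the length a = 𝓛(ν), and to transport along the axis
ℝe. Project ν by y ↦ ⟨e, y⟩ and let T be the quantile function of the projection on (0, 1). As supp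
ν is connected and a ν dominates ℋ¹ there, the projection has no gaps and is nowhere too thin, so T
is a-Lipschitz off a null set (`sub_le_of_hausdorff_restrict_le`).

Let σ be the sign of s - 1/2. A dual bound with the median T(1/2) as multiplier gives W₂² ≥ ∫ (T -
σ)² + ∫ dist(y, ℝe)² dν. Among such T, the one closest to σ in L² is the profile p, the line of
slope a through (1/2, 0) clamped to [-1, 1]. `exists_deficit_le_wasserstein` retains ∫ (T - p)² and
the off-axis term as a surplus, and this yields uniqueness at fixed a.

It remains to minimize the cost of p plus Λa over a ≥ 0 (`profileCost_add_lt`). The cost is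
quadratic for a ≤ 2 and equals 2/(3a) for a ≥ 2; the three regimes are an optimum beyond 2, in (0,
2], or at 0. The bound is reached by the law of p e, coupled to the datum through the same s. -/

/-! ### Uniform law on (0, 1) and quantile functions. -/

/-- Lebesgue measure on the open unit interval. -/
noncomputable abbrev unitVolume : Measure ℝ := volume.restrict (Set.Ioo 0 1)

instance isProbabilityMeasure_unitVolume : IsProbabilityMeasure unitVolume :=
  ⟨by simp [unitVolume]⟩

theorem ae_unitVolume_mem : ∀ᵐ s ∂unitVolume, s ∈ Set.Ioo (0 : ℝ) 1 :=
  ae_restrict_mem measurableSet_Ioo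

theorem volume_Ioo_inter_Iic {c : ℝ} (h1 : c ≤ 1) :
    volume (Set.Ioo (0 : ℝ) 1 ∩ Set.Iic c) = ENNReal.ofReal c := by
  apply le_antisymm
  · calc volume (Set.Ioo (0 : ℝ) 1 ∩ Set.Iic c) ≤ volume (Set.Ioc 0 c) := measure_mono (fun s hs => ⟨hs.1.1, hs.2⟩)
      _ = _ := by simp
  · calc ENNReal.ofReal c = volume (Set.Ioo 0 c) := by simp
      _ ≤ volume (Set.Ioo (0 : ℝ) 1 ∩ Set.Iic c) := measure_mono (fun s hs => ⟨⟨hs.1, hs.2.trans_le h1⟩, hs.2.le⟩)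

/-- Every probability measure on the line is the image of the uniform law on `(0, 1)` under a
monotone map. -/
theorem exists_monotoneOn_map_unitVolume_eq (μ : Measure ℝ) [IsProbabilityMeasure μ] :
    ∃ T : ℝ → ℝ, MonotoneOn T (Set.Ioo 0 1) ∧ AEMeasurable T unitVolume ∧
      unitVolume.map T = μ := by
  let F := ProbabilityTheory.cdf μ
  -- Outside (0, 1) this set can be empty or unbounded below, and `sInf` then returns the default 0;
  -- hence the open interval throughout.
  let T : ℝ → ℝ := fun s => sInf {x | s ≤ F x}
  -- Galois connection between quantile and distribution function; the forward direction needs right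
  -- continuity of F.
  have key : ∀ s ∈ Set.Ioo (0 : ℝ) 1, ∀ x, T s ≤ x ↔ s ≤ F x := by
    intro s hs x
    have hne : {x | s ≤ F x}.Nonempty := by
      obtain ⟨y, hy⟩ :=
        ((ProbabilityTheory.tendsto_cdf_atTop μ).eventually (lt_mem_nhds hs.2)).exists
      exact ⟨y, hy.le⟩
    have hbdd : BddBelow {x | s ≤ F x} := by
      obtain ⟨y, hy⟩ :=
        ((ProbabilityTheory.tendsto_cdf_atBot μ).eventually (gt_mem_nhds hs.1)).exists
      refine ⟨y, fun z hz => ?_⟩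
      by_contra! h
      have h1 : F z ≤ F y := F.mono h.le
      exact absurd (hz.trans h1) (not_le.mpr hy)
    constructor
    · intro h
      have hr : Filter.Tendsto F (nhdsWithin x (Set.Ioi x)) (nhds (F x)) :=
        (F.right_continuous x).mono_left (nhdsWithin_mono _ Set.Ioi_subset_Ici_self)
      refine ge_of_tendsto hr ?_
      filter_upwards [self_mem_nhdsWithin] with y hy
      obtain ⟨z, hz, hzy⟩ := exists_lt_of_csInf_lt hne (lt_of_le_of_lt h hy)
      exact le_trans hz (F.mono hzy.le)
    · intro h
      exact csInf_le hbdd h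
  have hmono : MonotoneOn T (Set.Ioo 0 1) := by
    intro s hs t ht hst
    rw [key s hs]
    exact hst.trans ((key t ht _).1 le_rfl)
  have hmeas : AEMeasurable T unitVolume :=
    aemeasurable_restrict_of_monotoneOn measurableSet_Ioo hmono
  refine ⟨T, hmono, hmeas, ?_⟩
  have : IsProbabilityMeasure (unitVolume.map T) := Measure.isProbabilityMeasure_map hmeas
  refine Measure.ext_of_Iic _ _ fun x => ?_
  rw [Measure.map_apply_of_aemeasurable hmeas measurableSet_Iic,
    Measure.restrict_apply' measurableSet_Ioo, ← ProbabilityTheory.ofReal_cdf,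
    ← volume_Ioo_inter_Iic (ProbabilityTheory.cdf_le_one μ x)]
  congr 1
  ext s
  constructor
  · rintro ⟨h1, h2⟩
    exact ⟨h2, (key s h2 x).1 h1⟩
  · rintro ⟨h1, h2⟩
    exact ⟨(key s h1 x).2 h2, h1⟩

/-- The reflection `s ↦ 1 - s` preserves the uniform law on `(0, 1)`. -/
theorem measurePreserving_one_sub_unitVolume :
    MeasurePreserving (fun s : ℝ => 1 - s) unitVolume unitVolume := by
  have h := (Measure.measurePreserving_sub_left (volume : Measure ℝ) 1).restrict_preimage
    (measurableSet_Ioo (a := (0 : ℝ)) (b := 1))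
  have h2 : (fun s : ℝ => 1 - s) ⁻¹' Set.Ioo 0 1 = Set.Ioo 0 1 := by
    ext s; simp
  rwa [h2] at h

theorem integral_one_sub_unitVolume (f : ℝ → ℝ) :
    ∫ s, f (1 - s) ∂unitVolume = ∫ s, f s ∂unitVolume :=
  measurePreserving_one_sub_unitVolume.integral_comp
    (Homeomorph.subLeft (1 : ℝ)).measurableEmbedding f

/-! ### The clamped profile and its cost. -/

/-- The sign of `s - 1/2`, with value `1` at `1/2`. -/
noncomputable def halfSign (s : ℝ) : ℝ := if s < 1 / 2 then -1 else 1

/-- The monotone transport profile: slope `a` around `1/2`, truncated to `[-1, 1]`. -/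
noncomputable def profile (a s : ℝ) : ℝ := max (-1) (min 1 (a * (s - 1 / 2)))

theorem measurable_halfSign : Measurable halfSign :=
  Measurable.ite measurableSet_Iio measurable_const measurable_const

theorem halfSign_sq (s : ℝ) : halfSign s ^ 2 = 1 := by
  unfold halfSign; split_ifs <;> norm_num

theorem abs_halfSign (s : ℝ) : |halfSign s| = 1 := by
  unfold halfSign; split_ifs <;> norm_num

theorem halfSign_one_sub {s : ℝ} (hs : s ≠ 1 / 2) : halfSign (1 - s) = -halfSign s := by
  unfold halfSign
  rcases lt_or_gt_of_ne hs with h | h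
  · rw [if_neg (by linarith), if_pos h, neg_neg]
  · rw [if_pos (by linarith), if_neg (by linarith)]

theorem continuous_profile (a : ℝ) : Continuous (profile a) := by
  unfold profile; fun_prop

theorem abs_profile_le (a s : ℝ) : |profile a s| ≤ 1 := by
  unfold profile
  rw [abs_le]
  exact ⟨le_max_left _ _, max_le (by norm_num) (min_le_left _ _)⟩

theorem profile_one_sub (a s : ℝ) : profile a (1 - s) = -profile a s := by
  unfold profile
  rw [← min_neg_neg, ← max_neg_neg, neg_neg,
    show a * (1 - s - 1 / 2) = -(a * (s - 1 / 2)) by ring, max_min_distrib_left]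
  rw [max_eq_right (by norm_num : (-1 : ℝ) ≤ 1)]

theorem lipschitzWith_profile (a : ℝ≥0) : LipschitzWith a (profile a) := by
  have h : LipschitzWith a fun s : ℝ => (a : ℝ) * (s - 1 / 2) := by
    refine LipschitzWith.of_dist_le_mul fun x y => ?_
    rw [Real.dist_eq, Real.dist_eq, ← mul_sub, abs_mul, NNReal.abs_eq]
    apply le_of_eq; congr 2; ring
  exact (h.const_min 1).const_max (-1)

theorem ae_unitVolume_ne_half : ∀ᵐ s ∂unitVolume, s ≠ (1 / 2 : ℝ) :=
  ae_restrict_of_ae (Measure.ae_ne volume _)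

theorem integral_halfSign : ∫ s, halfSign s ∂unitVolume = 0 := by
  have h := integral_one_sub_unitVolume halfSign
  have h2 : ∫ s, halfSign (1 - s) ∂unitVolume = ∫ s, -halfSign s ∂unitVolume := by
    apply integral_congr_ae
    filter_upwards [ae_unitVolume_ne_half] with s hs using halfSign_one_sub hs
  rw [integral_neg] at h2
  linarith

/-- The transport cost between `½ (δ₋₁ + δ₁)` and the law of `profile a`. -/
noncomputable def profileCost (a : ℝ) : ℝ := ∫ s, (profile a s - halfSign s) ^ 2 ∂unitVolume

theorem integrable_profile_sub_halfSign_sq (a : ℝ) :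
    Integrable (fun s => (profile a s - halfSign s) ^ 2) unitVolume := by
  refine Integrable.of_bound (C := 4) ?_ (Filter.Eventually.of_forall fun s => ?_)
  · exact (((continuous_profile a).measurable.sub measurable_halfSign).pow_const 2).aestronglyMeasurable
  · rw [Real.norm_eq_abs, abs_pow]
    have := abs_sub (profile a s) (halfSign s)
    have h1 := abs_profile_le a s
    have h2 := abs_halfSign s
    have h3 := abs_nonneg (profile a s - halfSign s)
    nlinarith

theorem profileCost_nonneg (a : ℝ) : 0 ≤ profileCost a :=
  integral_nonneg fun _ => sq_nonneg _

theorem integral_affine_sq (c a p q : ℝ) :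
    ∫ s in p..q, (c + a * (s - 1 / 2)) ^ 2 =
      (c ^ 2 * q + c * a * (q - 1 / 2) ^ 2 + a ^ 2 * (q - 1 / 2) ^ 3 / 3) -
      (c ^ 2 * p + c * a * (p - 1 / 2) ^ 2 + a ^ 2 * (p - 1 / 2) ^ 3 / 3) := by
  refine intervalIntegral.integral_eq_sub_of_hasDerivAt
    (f := fun x => c ^ 2 * x + c * a * (x - 1 / 2) ^ 2 + a ^ 2 * (x - 1 / 2) ^ 3 / 3)
    (fun x _ => ?_)
    (Continuous.intervalIntegrable (by fun_prop) _ _)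
  have h1 : HasDerivAt (fun x : ℝ => x - 1 / 2) 1 x := (hasDerivAt_id x).sub_const _
  have h := (((hasDerivAt_id x).const_mul (c ^ 2)).add ((h1.pow 2).const_mul (c * a))).add
    (((h1.pow 3).const_mul (a ^ 2)).div_const 3)
  refine h.congr_deriv ?_
  simp; ring

/-- The clamp is inactive exactly within distance m of 1/2. Beyond that the profile equals the sign
and costs nothing, or, when m = 1/2, no interval is left. Taking m = 1/2 or m = 1/a treats slopes
below and above 2 together. -/
theorem profileCost_eq {a m : ℝ} (ha : 0 ≤ a) (hm0 : 0 ≤ m) (hm : m ≤ 1 / 2) (ham : a * m ≤ 1)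
    (h : m = 1 / 2 ∨ a * m = 1) :
    profileCost a = 2 * (m - a * m ^ 2 + a ^ 2 * m ^ 3 / 3) := by
  set f : ℝ → ℝ := fun s => (profile a s - halfSign s) ^ 2 with hf
  have hint : ∀ p q, 0 ≤ p → p ≤ q → q ≤ 1 → IntervalIntegrable f volume p q := by
    intro p q hp hpq hq
    rw [intervalIntegrable_iff_integrableOn_Ioo_of_le hpq]
    exact (integrable_profile_sub_halfSign_sq a).mono_measure
      (Measure.restrict_mono (Set.Ioo_subset_Ioo hp hq) le_rfl)
  have e0 : profileCost a = ∫ s in (0 : ℝ)..1, f s := by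
    rw [intervalIntegral.integral_of_le zero_le_one, integral_Ioc_eq_integral_Ioo]; rfl
  have c1 : ∫ s in (0 : ℝ)..(1 / 2 - m), f s = 0 := by
    rw [intervalIntegral.integral_of_le (by linarith), integral_Ioc_eq_integral_Ioo]
    refine setIntegral_eq_zero_of_forall_eq_zero fun s hs => ?_
    have ham1 : a * m = 1 := h.resolve_left (by rintro rfl; linarith [hs.1, hs.2])
    have h3 : a * (s - 1 / 2) ≤ -1 := by nlinarith [hs.1, hs.2]
    simp only [hf, profile, halfSign]
    rw [if_pos (by linarith [hs.2]), min_eq_right (by linarith), max_eq_left h3]; norm_num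
  have c2 : ∫ s in (1 / 2 - m)..(1 / 2), f s = ∫ s in (1 / 2 - m)..(1 / 2),
      (1 + a * (s - 1 / 2)) ^ 2 := by
    rw [intervalIntegral.integral_of_le (by linarith), integral_Ioc_eq_integral_Ioo,
      intervalIntegral.integral_of_le (by linarith), integral_Ioc_eq_integral_Ioo]
    refine setIntegral_congr_fun measurableSet_Ioo fun s hs => ?_
    have h3 : -1 ≤ a * (s - 1 / 2) := by nlinarith [hs.1, hs.2]
    have h4 : a * (s - 1 / 2) ≤ 1 := by nlinarith [hs.1, hs.2]
    simp only [hf, profile, halfSign]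
    rw [if_pos (by linarith [hs.2]), min_eq_right h4, max_eq_right h3]; ring
  have c3 : ∫ s in (1 / 2)..(1 / 2 + m), f s = ∫ s in (1 / 2)..(1 / 2 + m),
      (-1 + a * (s - 1 / 2)) ^ 2 := by
    rw [intervalIntegral.integral_of_le (by linarith), integral_Ioc_eq_integral_Ioo,
      intervalIntegral.integral_of_le (by linarith), integral_Ioc_eq_integral_Ioo]
    refine setIntegral_congr_fun measurableSet_Ioo fun s hs => ?_
    have h3 : -1 ≤ a * (s - 1 / 2) := by nlinarith [hs.1, hs.2]
    have h4 : a * (s - 1 / 2) ≤ 1 := by nlinarith [hs.1, hs.2]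
    simp only [hf, profile, halfSign]
    rw [if_neg (by linarith [hs.1]), min_eq_right h4, max_eq_right h3]; ring
  have c4 : ∫ s in (1 / 2 + m)..1, f s = 0 := by
    rw [intervalIntegral.integral_of_le (by linarith), integral_Ioc_eq_integral_Ioo]
    refine setIntegral_eq_zero_of_forall_eq_zero fun s hs => ?_
    have ham1 : a * m = 1 := h.resolve_left (by rintro rfl; linarith [hs.1, hs.2])
    have h3 : 1 ≤ a * (s - 1 / 2) := by nlinarith [hs.1, hs.2]
    simp only [hf, profile, halfSign]
    rw [if_neg (by linarith [hs.1]), min_eq_left h3, max_eq_right (by norm_num)]; norm_num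
  have i1 := hint 0 (1 / 2 - m) le_rfl (by linarith) (by linarith)
  have i2 := hint (1 / 2 - m) (1 / 2) (by linarith) (by linarith) (by linarith)
  have i3 := hint (1 / 2) (1 / 2 + m) (by linarith) (by linarith) (by linarith)
  have i4 := hint (1 / 2 + m) 1 (by linarith) (by linarith) (by linarith)
  rw [e0, ← intervalIntegral.integral_add_adjacent_intervals ((i1.trans i2).trans i3) i4,
    ← intervalIntegral.integral_add_adjacent_intervals (i1.trans i2) i3,
    ← intervalIntegral.integral_add_adjacent_intervals i1 i2, c1, c2, c3, c4,
    integral_affine_sq, integral_affine_sq]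
  ring

theorem profileCost_of_le_two {a : ℝ} (ha : 0 ≤ a) (h : a ≤ 2) :
    profileCost a = 1 - a / 2 + a ^ 2 / 12 := by
  rw [profileCost_eq (m := 1 / 2) ha (by norm_num) le_rfl (by linarith) (Or.inl rfl)]
  ring

theorem profileCost_of_two_le {a : ℝ} (h : 2 ≤ a) : profileCost a = 2 / (3 * a) := by
  have ha : 0 < a := by linarith
  have h1 : a * (1 / a) = 1 := by field_simp
  rw [profileCost_eq (m := 1 / a) ha.le (by positivity)
    (one_div_le_one_div_of_le (by norm_num) h) h1.le (Or.inr h1)]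
  field_simp
  ring

/-! ### Minimization over the slope. -/

/-- The length of the optimal measure (up to the two atoms, its inverse density). -/
noncomputable def optimalLength (Λ : ℝ) : ℝ :=
  if Λ < 1 / 6 then 1 / √(3 * Λ / 2) else if Λ < 1 / 2 then 3 * (1 - 2 * Λ) else 0

theorem optimalLength_nonneg (Λ : ℝ) : 0 ≤ optimalLength Λ := by
  unfold optimalLength
  split_ifs
  · positivity
  · linarith
  · exact le_rfl

theorem sqrt_density_bounds {Λ : ℝ} (hΛ : 0 < Λ) (h : Λ < 1 / 6) :
    0 < √(3 * Λ / 2) ∧ √(3 * Λ / 2) < 1 / 2 := by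
  refine ⟨Real.sqrt_pos.2 (by linarith), ?_⟩
  rw [Real.sqrt_lt' (by norm_num)]
  linarith

/-- The optimal length is the unique minimizer of `a ↦ profileCost a + Λ a` on `[0, ∞)`. -/
theorem profileCost_add_lt {Λ : ℝ} (hΛ : 0 < Λ) {a : ℝ} (ha : 0 ≤ a) (hne : a ≠ optimalLength Λ) :
    profileCost (optimalLength Λ) + Λ * optimalLength Λ < profileCost a + Λ * a := by
  -- The left side is the energy at slope 2, so for Λ ≥ 1/6 going past slope 2 never helps.
  have hbig : ∀ a, 2 < a → 1 / 6 ≤ Λ → 1 / 3 + Λ * 2 < 2 / (3 * a) + Λ * a := by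
    intro a ha h
    have : 2 / (3 * a) + Λ * a - (1 / 3 + Λ * 2) = (a - 2) * (Λ - 1 / (3 * a)) := by
      field_simp; ring
    have h2 : 1 / (3 * a) < 1 / 6 := one_div_lt_one_div_of_lt (by norm_num) (by linarith)
    nlinarith
  unfold optimalLength at hne ⊢
  split_ifs at hne ⊢ with h1 h2
  · obtain ⟨hr0, hr1⟩ := sqrt_density_bounds hΛ h1
    have hr2 : √(3 * Λ / 2) ^ 2 = 3 * Λ / 2 := Real.sq_sqrt (by linarith)
    set r := √(3 * Λ / 2)
    have hL : Λ = 2 * r ^ 2 / 3 := by linarith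
    have h2r : 2 < 1 / r := by rw [lt_div_iff₀ hr0]; linarith
    rw [profileCost_of_two_le h2r.le, hL]
    have e : 2 / (3 * (1 / r)) + 2 * r ^ 2 / 3 * (1 / r) = 4 * r / 3 := by field_simp; ring
    rw [e]
    rcases le_or_gt a 2 with h | h
    · rw [profileCost_of_le_two ha h]
      nlinarith [sq_nonneg (a - 2), sq_nonneg (1 - 2 * r), mul_nonneg ha (sub_nonneg.2 h),
        mul_pos (sub_pos.2 hr1) hr0, mul_nonneg (sub_nonneg.2 h) (sub_pos.2 hr1).le,
        mul_nonneg (mul_nonneg (sub_nonneg.2 h) (sub_pos.2 hr1).le) hr0.le]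
    · rw [profileCost_of_two_le h.le]
      have hne' : r * a - 1 ≠ 0 := by
        intro h0
        exact hne (by field_simp; linarith)
      have : 2 / (3 * a) + 2 * r ^ 2 / 3 * a - 4 * r / 3 = 2 * (r * a - 1) ^ 2 / (3 * a) := by
        field_simp; ring
      have : 0 < 2 * (r * a - 1) ^ 2 / (3 * a) := by positivity
      linarith
  · push Not at h1
    rw [profileCost_of_le_two (by linarith) (by linarith)]
    -- Completing the square: the vertex 3(1 - 2Λ) lies in (0, 2] in this regime.
    have hq : ∀ b : ℝ, 1 - b / 2 + b ^ 2 / 12 + Λ * b = 1 - 3 / 4 * (1 - 2 * Λ) ^ 2 +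
        (b - 3 * (1 - 2 * Λ)) ^ 2 / 12 := fun b => by ring
    rcases le_or_gt a 2 with h | h
    · rw [profileCost_of_le_two ha h, hq, hq]
      have := sq_pos_of_ne_zero (sub_ne_zero.2 hne)
      nlinarith
    · rw [profileCost_of_two_le h.le]
      have h3 := hbig a h h1
      have h4 := hq 2
      rw [hq]
      nlinarith [sq_nonneg (2 - 3 * (1 - 2 * Λ))]
  · push Not at h1 h2
    rw [profileCost_of_le_two le_rfl (by norm_num)]
    have hpos : 0 < a := lt_of_le_of_ne ha (Ne.symm hne)
    rcases le_or_gt a 2 with h | h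
    · rw [profileCost_of_le_two ha h]
      nlinarith [mul_nonneg (sub_nonneg.2 h2) ha, sq_pos_of_ne_zero hpos.ne']
    · rw [profileCost_of_two_le h.le]
      have h3 := hbig a h h1
      linarith

open LengthRelaxation

/-! ### Projection onto the axis. -/

section InnerProduct

variable {E : Type*} [NormedAddCommGroup E] [InnerProductSpace ℝ E]

theorem sq_inner_le_norm_sq {e : E} (he : ‖e‖ = 1) (y : E) : (inner ℝ e y : ℝ) ^ 2 ≤ ‖y‖ ^ 2 := by
  have := norm_inner_le_norm (𝕜 := ℝ) e y
  rw [he, one_mul, Real.norm_eq_abs] at this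
  rw [← sq_abs]
  exact pow_le_pow_left₀ (abs_nonneg _) this 2

theorem norm_sub_inner_smul_sq {e : E} (he : ‖e‖ = 1) (y : E) :
    ‖y - (inner ℝ e y : ℝ) • e‖ ^ 2 = ‖y‖ ^ 2 - (inner ℝ e y : ℝ) ^ 2 := by
  rw [norm_sub_sq_real, inner_smul_right, norm_smul, he, real_inner_comm]
  rw [mul_one, Real.norm_eq_abs, sq_abs]
  ring

theorem lipschitzWith_inner {e : E} (he : ‖e‖ = 1) :
    LipschitzWith 1 (fun y => (inner ℝ e y : ℝ)) := by
  refine LipschitzWith.of_dist_le_mul fun x y => ?_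
  rw [Real.dist_eq, ← inner_sub_right, dist_eq_norm, NNReal.coe_one, one_mul]
  simpa [he] using abs_real_inner_le_norm e (x - y)

end InnerProduct

/-! ### Transport plans and the dual bound. -/

section Plans

theorem wasserstein_two_rpow_two {X : Type*} [MetricSpace X] [MeasurableSpace X]
    (ρ ν : Measure X) :
    wasserstein 2 ρ ν ^ (2 : ℝ) =
      ⨅ (γ : Measure (X × X)) (_ : IsTransportPlan ρ ν γ), ∫⁻ z, edist z.1 z.2 ^ (2 : ℝ) ∂γ := by
  rw [wasserstein, ← ENNReal.rpow_mul]
  norm_num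

theorem edist_rpow_two {E : Type*} [NormedAddCommGroup E] (x y : E) :
    edist x y ^ (2 : ℝ) = ENNReal.ofReal (‖x - y‖ ^ 2) := by
  rw [edist_dist, dist_eq_norm, ENNReal.ofReal_rpow_of_nonneg (norm_nonneg _) (by norm_num)]
  norm_num

variable {E : Type*} [NormedAddCommGroup E] [MeasurableSpace E] [BorelSpace E]

theorem integrable_norm_sq_of_mem_finiteMomentProbability {ν : Measure E}
    (hν : ν ∈ finiteMomentProbability E 2) : Integrable (fun y => ‖y‖ ^ 2) ν := by
  refine ⟨(measurable_norm.pow_const 2).aestronglyMeasurable, ?_⟩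
  rw [hasFiniteIntegral_iff_enorm]
  refine lt_of_eq_of_lt (lintegral_congr fun y => ?_) hν.2
  rw [Real.enorm_eq_ofReal (by positivity), ← ofReal_norm,
    ENNReal.ofReal_rpow_of_nonneg (norm_nonneg _) (by norm_num)]
  norm_num

theorem ae_twoDiracs (e : E) : ∀ᵐ x ∂(twoDiracs e), x = -e ∨ x = e := by
  unfold twoDiracs
  refine Measure.ae_smul_measure ?_ _
  rw [ae_add_measure_iff, ae_dirac_iff, ae_dirac_iff]
  · exact ⟨Or.inl rfl, Or.inr rfl⟩
  all_goals exact (measurableSet_singleton _).union (measurableSet_singleton _)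

variable [InnerProductSpace ℝ E]

theorem integrable_inner_of_mem_finiteMomentProbability {e : E} (he : ‖e‖ = 1) {ν : Measure E}
    (hν : ν ∈ finiteMomentProbability E 2) : Integrable (fun y => inner ℝ e y) ν := by
  have := hν.1
  refine ((integrable_const (1 : ℝ)).add
    (integrable_norm_sq_of_mem_finiteMomentProbability hν)).mono' ?_ ?_
  · exact (continuous_const.inner continuous_id).measurable.aestronglyMeasurable
  · refine Filter.Eventually.of_forall fun y => ?_
    have := norm_inner_le_norm (𝕜 := ℝ) e y
    rw [he, one_mul] at this
    simp only [Pi.add_apply]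
    nlinarith [sq_nonneg (‖y‖ - 1), norm_nonneg y]

theorem integral_inner_twoDiracs (e : E) : ∫ x, (inner ℝ e x : ℝ) ∂(twoDiracs e) = 0 := by
  unfold twoDiracs
  have hm : StronglyMeasurable fun x : E => (inner ℝ e x : ℝ) :=
    (continuous_const.inner continuous_id).measurable.stronglyMeasurable
  rw [integral_smul_measure, integral_add_measure, integral_dirac' _ _ hm, integral_dirac' _ _ hm]
  · simp
  · exact (integrable_dirac' hm (by simp))
  · exact (integrable_dirac' hm (by simp))

/-- Kantorovich-type lower bound for the quadratic cost of a plan starting from two Diracs. -/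
theorem ofReal_integral_le_planCost [SecondCountableTopology E] {e : E} (he : ‖e‖ = 1) {ν : Measure E}
    (hν : ν ∈ finiteMomentProbability E 2) {γ : Measure (E × E)}
    (hγ : IsTransportPlan (twoDiracs e) ν γ) (c : ℝ) :
    ENNReal.ofReal (∫ y, (1 + ‖y‖ ^ 2 - 2 * |(inner ℝ e y : ℝ) - c|) ∂ν) ≤
      ∫⁻ z, edist z.1 z.2 ^ (2 : ℝ) ∂γ := by
  have := hν.1
  obtain ⟨h1, h2⟩ := hγ
  have hprob : IsProbabilityMeasure γ := by
    constructor
    rw [← measure_univ (μ := ν), ← h2, Measure.map_apply measurable_snd MeasurableSet.univ,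
      Set.preimage_univ]
  have hfst : ∀ᵐ z ∂γ, z.1 = -e ∨ z.1 = e :=
    ae_of_ae_map measurable_fst.aemeasurable (h1 ▸ ae_twoDiracs e)
  have hin : Measurable fun y : E => (inner ℝ e y : ℝ) :=
    (continuous_const.inner continuous_id).measurable
  have iσ : Integrable (fun z : E × E => (inner ℝ e z.1 : ℝ)) γ := by
    refine Integrable.of_bound (C := 1) (hin.comp measurable_fst).aestronglyMeasurable ?_
    filter_upwards [hfst] with z hz
    rcases hz with hz | hz <;> simp [hz, he]
  have sσ : ∫ z, (inner ℝ e z.1 : ℝ) ∂γ = 0 := by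
    rw [← integral_inner_twoDiracs e, ← h1, integral_map measurable_fst.aemeasurable
      hin.aestronglyMeasurable]
  have iG : Integrable (fun y => 1 + ‖y‖ ^ 2 - 2 * |(inner ℝ e y : ℝ) - c|) ν :=
    ((integrable_const 1).add (integrable_norm_sq_of_mem_finiteMomentProbability hν)).sub
      (((integrable_inner_of_mem_finiteMomentProbability he hν).sub
        (integrable_const c)).abs.const_mul 2)
  have iG' : Integrable (fun z : E × E => 1 + ‖z.2‖ ^ 2 - 2 * |(inner ℝ e z.2 : ℝ) - c|) γ := by
    rw [← h2] at iG
    exact iG.comp_measurable measurable_snd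
  have iN : Integrable (fun z : E × E => ‖z.2‖ ^ 2) γ := by
    have := integrable_norm_sq_of_mem_finiteMomentProbability hν
    rw [← h2] at this
    exact this.comp_measurable measurable_snd
  have hexp : ∀ᵐ z ∂γ, ‖z.1 - z.2‖ ^ 2 =
      1 + ‖z.2‖ ^ 2 - 2 * ((inner ℝ e z.1 : ℝ) * (inner ℝ e z.2 : ℝ)) := by
    filter_upwards [hfst] with z hz
    rw [norm_sub_sq_real]
    rcases hz with hz | hz <;> simp [hz, he] <;> ring
  -- With σ = ⟨e, z.1⟩ = ±1, one has σ⟨e, z.2⟩ ≤ |⟨e, z.2⟩ - c| + cσ. The term in cσ integrates to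
  -- zero because the datum is centred, so c is free.
  have hle : ∀ᵐ z ∂γ, 1 + ‖z.2‖ ^ 2 - 2 * |(inner ℝ e z.2 : ℝ) - c|
      - 2 * c * (inner ℝ e z.1 : ℝ) ≤ ‖z.1 - z.2‖ ^ 2 := by
    filter_upwards [hfst, hexp] with z hz hz2
    rw [hz2]
    have hp := le_abs_self ((inner ℝ e z.2 : ℝ) - c)
    have hm := neg_abs_le ((inner ℝ e z.2 : ℝ) - c)
    rcases hz with hz | hz
    · have : (inner ℝ e z.1 : ℝ) = -1 := by simp [hz, he]
      rw [this]; linarith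
    · have : (inner ℝ e z.1 : ℝ) = 1 := by simp [hz, he]
      rw [this]; linarith
  have iC : Integrable (fun z : E × E => ‖z.1 - z.2‖ ^ 2) γ := by
    refine ((integrable_const (2 : ℝ)).add (iN.const_mul 2)).mono'
      ((measurable_fst.sub measurable_snd).norm.pow_const 2).aestronglyMeasurable ?_
    filter_upwards [hfst] with z hz
    have h3 : ‖z.1‖ = 1 := by rcases hz with hz | hz <;> simp [hz, he]
    have h4 := norm_sub_le z.1 z.2
    rw [h3] at h4
    simp only [Pi.add_apply, Real.norm_eq_abs, abs_pow, abs_norm]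
    nlinarith [norm_nonneg (z.1 - z.2), sq_nonneg (‖z.2‖ - 1)]
  simp_rw [edist_rpow_two]
  rw [← ofReal_integral_eq_lintegral_ofReal iC (Filter.Eventually.of_forall fun _ => by positivity)]
  apply ENNReal.ofReal_le_ofReal
  calc ∫ y, (1 + ‖y‖ ^ 2 - 2 * |(inner ℝ e y : ℝ) - c|) ∂ν
      = ∫ z, (1 + ‖z.2‖ ^ 2 - 2 * |(inner ℝ e z.2 : ℝ) - c|) ∂γ := by
        rw [← h2] at iG ⊢
        exact integral_map measurable_snd.aemeasurable iG.aestronglyMeasurable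
    _ = ∫ z, (1 + ‖z.2‖ ^ 2 - 2 * |(inner ℝ e z.2 : ℝ) - c| - 2 * c * (inner ℝ e z.1 : ℝ)) ∂γ := by
        rw [integral_sub iG' (iσ.const_mul _), integral_const_mul, sσ, mul_zero, sub_zero]
    _ ≤ _ := integral_mono_ae (iG'.sub (iσ.const_mul _)) iC hle

end Plans

/-! ### The lower bound with its deficit. -/

section LowerBound

/-- Only increments of the quantile function are controlled, so a pointwise comparison at s would
fail under translation; pairing s with 1 - s removes this. Writing p and σ for profile and sign at
s, the sum equals 2(p - σ)(t - t' - 2p): either p = σ, or 2p = a(2s - 1) and the two factors do not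
have opposite signs. -/
theorem sq_add_sq_le_of_slope {a : ℝ≥0} {s t t' : ℝ} (hs : s ≠ 1 / 2)
    (h : halfSign s * (t - t') ≤ halfSign s * (a * (2 * s - 1))) :
    0 ≤ ((t - halfSign s) ^ 2 - (profile a s - halfSign s) ^ 2 - (t - profile a s) ^ 2) +
      ((t' - halfSign (1 - s)) ^ 2 - (profile a (1 - s) - halfSign (1 - s)) ^ 2 -
        (t' - profile a (1 - s)) ^ 2) := by
  rw [halfSign_one_sub hs, profile_one_sub]
  have ha := a.coe_nonneg
  rcases lt_or_gt_of_ne hs with hs | hs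
  · have e : halfSign s = -1 := if_pos hs
    have h0 : (a : ℝ) * (s - 1 / 2) ≤ 0 := mul_nonpos_of_nonneg_of_nonpos ha (by linarith)
    rw [e] at h ⊢
    unfold profile
    rw [min_eq_right (by linarith)]
    rcases le_total (-1) ((a : ℝ) * (s - 1 / 2)) with h1 | h1
    · rw [max_eq_right h1]; nlinarith
    · rw [max_eq_left h1]; nlinarith
  · have e : halfSign s = 1 := if_neg (by linarith)
    have h0 : 0 ≤ (a : ℝ) * (s - 1 / 2) := mul_nonneg ha (by linarith)
    rw [e] at h ⊢
    unfold profile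
    rw [max_eq_right (by rw [le_min_iff]; constructor <;> linarith)]
    rcases le_total 1 ((a : ℝ) * (s - 1 / 2)) with h1 | h1
    · rw [min_eq_left h1]; nlinarith
    · rw [min_eq_right h1]; nlinarith

variable {E : Type*} [NormedAddCommGroup E] [InnerProductSpace ℝ E] [MeasurableSpace E]
  [BorelSpace E]

/-- The monotone parametrization of a projected measure of bounded inverse density is Lipschitz. -/
theorem sub_le_of_hausdorff_restrict_le {e : E} (he : ‖e‖ = 1) {ν : Measure E}
    {a : ℝ≥0} (hconn : IsConnected ν.support)
    (hle : (Measure.hausdorffMeasure 1 : Measure E).restrict ν.support ≤ a • ν)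
    {T : ℝ → ℝ} (hmono : MonotoneOn T (Set.Ioo 0 1)) (hT : AEMeasurable T unitVolume)
    (hmap : unitVolume.map T = ν.map fun y => (inner ℝ e y : ℝ)) {s t : ℝ}
    (hs : s ∈ Set.Ioo (0 : ℝ) 1) (ht : t ∈ Set.Ioo (0 : ℝ) 1) (hst : s ≤ t)
    (hTs : T s ∈ (fun y => (inner ℝ e y : ℝ)) '' ν.support)
    (hTt : T t ∈ (fun y => (inner ℝ e y : ℝ)) '' ν.support) :
    T t - T s ≤ a * (t - s) := by
  set f : E → ℝ := fun y => (inner ℝ e y : ℝ) with hf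
  have hfm : Measurable f := (lipschitzWith_inner he).continuous.measurable
  have hord : (f '' ν.support).OrdConnected :=
    (hconn.isPreconnected.image f (lipschitzWith_inner he).continuous.continuousOn).ordConnected
  -- Connectedness makes the projected support cover the gap between T s and T t, and projecting
  -- does not increase ℋ¹; the slab over the gap has ν-mass at most t - s.
  have key : ENNReal.ofReal (T t - T s) ≤ ENNReal.ofReal (a * (t - s)) := by
    calc ENNReal.ofReal (T t - T s)
        = Measure.hausdorffMeasure 1 (Set.Ioo (T s) (T t)) := by
          rw [hausdorffMeasure_real, Real.volume_Ioo]
      _ ≤ Measure.hausdorffMeasure 1 (f '' (f ⁻¹' Set.Ioo (T s) (T t) ∩ ν.support)) := by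
          refine measure_mono fun x hx => ?_
          obtain ⟨y, hy, rfl⟩ := hord.out hTs hTt (Set.Ioo_subset_Icc_self hx)
          exact ⟨y, ⟨hx, hy⟩, rfl⟩
      _ ≤ Measure.hausdorffMeasure 1 (f ⁻¹' Set.Ioo (T s) (T t) ∩ ν.support) := by
          simpa using (lipschitzWith_inner he).hausdorffMeasure_image_le zero_le_one
            (f ⁻¹' Set.Ioo (T s) (T t) ∩ ν.support)
      _ = (Measure.hausdorffMeasure 1 : Measure E).restrict ν.support
            (f ⁻¹' Set.Ioo (T s) (T t)) :=
          (Measure.restrict_apply (hfm measurableSet_Ioo)).symm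
      _ ≤ (a • ν) (f ⁻¹' Set.Ioo (T s) (T t)) := hle _
      _ = a * unitVolume (T ⁻¹' Set.Ioo (T s) (T t)) := by
          rw [Measure.smul_apply, ← Measure.map_apply hfm measurableSet_Ioo, ← hmap,
            Measure.map_apply_of_aemeasurable hT measurableSet_Ioo]
          rfl
      -- The open interval matters: T may be constant across s or t, but values strictly between T s
      -- and T t are taken only within [s, t].
      _ ≤ a * volume (Set.Icc s t) := by
          refine mul_le_mul' le_rfl ?_
          rw [Measure.restrict_apply' measurableSet_Ioo]
          refine measure_mono ?_
          rintro x ⟨⟨h1, h2⟩, hx⟩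
          constructor
          · by_contra! h
            exact absurd (hmono hx hs h.le) (not_le.2 h1)
          · by_contra! h
            exact absurd (hmono ht hx h.le) (not_le.2 h2)
      _ = ENNReal.ofReal (a * (t - s)) := by
          rw [Real.volume_Icc, ENNReal.ofReal_mul a.coe_nonneg, ENNReal.ofReal_coe_nnreal]
  exact (ENNReal.ofReal_le_ofReal_iff (mul_nonneg a.coe_nonneg (sub_nonneg.2 hst))).1 key

/-- Supplies the membership hypotheses of `sub_le_of_hausdorff_restrict_le` almost everywhere.
Connectedness makes the projected support an interval, hence Borel. -/
theorem ae_mem_image_support [SecondCountableTopology E] {e : E} (he : ‖e‖ = 1) {ν : Measure E}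
    (hconn : IsConnected ν.support) {T : ℝ → ℝ} (hT : AEMeasurable T unitVolume)
    (hmap : unitVolume.map T = ν.map fun y => (inner ℝ e y : ℝ)) :
    ∀ᵐ s ∂unitVolume, T s ∈ (fun y => (inner ℝ e y : ℝ)) '' ν.support := by
  have hcont := (lipschitzWith_inner he).continuous
  have hord : ((fun y => (inner ℝ e y : ℝ)) '' ν.support).OrdConnected :=
    (hconn.isPreconnected.image _ hcont.continuousOn).ordConnected
  refine ae_of_ae_map (p := fun x => x ∈ (fun y => (inner ℝ e y : ℝ)) '' ν.support) hT ?_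
  rw [hmap]
  refine (ae_map_iff hcont.measurable.aemeasurable hord.measurableSet).2 ?_
  filter_upwards [Measure.support_mem_ae (μ := ν)] with y hy using ⟨y, hy, rfl⟩

/-- The transport cost exceeds the cost of the optimal profile by a deficit that vanishes only for
the law of that profile. -/
theorem exists_deficit_le_wasserstein [SecondCountableTopology E] {e : E} (he : ‖e‖ = 1)
    {ν : Measure E} (hν : ν ∈ finiteMomentProbability E 2) {a : ℝ≥0}
    (hconn : IsConnected ν.support)
    (hle : (Measure.hausdorffMeasure 1 : Measure E).restrict ν.support ≤ a • ν) :
    ∃ D : ℝ, 0 ≤ D ∧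
      ENNReal.ofReal (profileCost a + D) ≤ wasserstein 2 (twoDiracs e) ν ^ (2 : ℝ) ∧
      (D = 0 → ν = unitVolume.map fun s => profile a s • e) := by
  have hprob := hν.1
  set f : E → ℝ := fun y => (inner ℝ e y : ℝ) with hf
  have hfm : Measurable f := (lipschitzWith_inner he).continuous.measurable
  have hprob' : IsProbabilityMeasure (ν.map f) :=
    Measure.isProbabilityMeasure_map hfm.aemeasurable
  obtain ⟨T, hmono, hT, hmap⟩ := exists_monotoneOn_map_unitVolume_eq (ν.map f)
  have hmem := ae_mem_image_support he hconn hT hmap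
  have hmem' : ∀ᵐ s ∂unitVolume, T (1 - s) ∈ f '' ν.support :=
    measurePreserving_one_sub_unitVolume.quasiMeasurePreserving.ae hmem
  have iN := integrable_norm_sq_of_mem_finiteMomentProbability hν
  have if1 := integrable_inner_of_mem_finiteMomentProbability he hν
  have if2 : Integrable (fun y => f y ^ 2) ν := by
    refine iN.mono' (hfm.pow_const 2).aestronglyMeasurable (Filter.Eventually.of_forall fun y => ?_)
    rw [Real.norm_eq_abs, abs_of_nonneg (sq_nonneg _)]
    exact sq_inner_le_norm_sq he y
  have tr : ∀ g : ℝ → ℝ, Continuous g → Integrable (fun y => g (f y)) ν →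
      Integrable (fun s => g (T s)) unitVolume ∧
        ∫ s, g (T s) ∂unitVolume = ∫ y, g (f y) ∂ν := by
    intro g hg hi
    have h1 : Integrable g (ν.map f) :=
      (integrable_map_measure hg.measurable.aestronglyMeasurable hfm.aemeasurable).2 hi
    rw [← integral_map hfm.aemeasurable hg.measurable.aestronglyMeasurable, ← hmap,
      integral_map hT hg.measurable.aestronglyMeasurable]
    rw [← hmap] at h1
    exact ⟨(integrable_map_measure hg.measurable.aestronglyMeasurable hT).1 h1, rfl⟩
  have iT1 : Integrable T unitVolume := (tr (fun x => x) continuous_id if1).1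
  have iT2 : Integrable (fun s => T s ^ 2) unitVolume := (tr (fun x => x ^ 2) (by fun_prop) if2).1
  have iσT : Integrable (fun s => halfSign s * T s) unitVolume :=
    iT1.bdd_mul measurable_halfSign.aestronglyMeasurable
      (Filter.Eventually.of_forall fun s => (abs_halfSign s).le)
  have ipT : Integrable (fun s => profile a s * T s) unitVolume :=
    iT1.bdd_mul (continuous_profile a).measurable.aestronglyMeasurable
      (Filter.Eventually.of_forall fun s => abs_profile_le a s)
  have iσ : Integrable halfSign unitVolume :=
    Integrable.of_bound measurable_halfSign.aestronglyMeasurable 1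
      (Filter.Eventually.of_forall fun s => (abs_halfSign s).le)
  have ip2 : Integrable (fun s => profile a s ^ 2) unitVolume := by
    refine Integrable.of_bound ((continuous_profile a).pow 2).measurable.aestronglyMeasurable 1
      (Filter.Eventually.of_forall fun s => ?_)
    rw [Real.norm_eq_abs, abs_pow]
    exact pow_le_one₀ (abs_nonneg _) (abs_profile_le a s)
  have iA : Integrable (fun s => (T s - halfSign s) ^ 2) unitVolume := by
    refine ((iT2.sub (iσT.const_mul 2)).add (integrable_const 1)).congr
      (Filter.Eventually.of_forall fun s => ?_)
    simp only [Pi.add_apply, Pi.sub_apply]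
    rw [← halfSign_sq s]; ring
  have iB : Integrable (fun s => (T s - profile a s) ^ 2) unitVolume := by
    refine ((iT2.sub (ipT.const_mul 2)).add ip2).congr (Filter.Eventually.of_forall fun s => ?_)
    simp only [Pi.add_apply, Pi.sub_apply]
    ring
  have iP := integrable_profile_sub_halfSign_sq a
  have iK : Integrable (fun y => ‖y‖ ^ 2 - f y ^ 2) ν := iN.sub if2
  have hK : ∀ y, 0 ≤ ‖y‖ ^ 2 - f y ^ 2 := fun y => sub_nonneg.2 (sq_inner_le_norm_sq he y)
  -- Integrated form of `sq_add_sq_le_of_slope`: the reflection preserves the uniform law, so the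
  -- paired integral is twice the single one.
  have hdef : profileCost a + ∫ s, (T s - profile a s) ^ 2 ∂unitVolume ≤
      ∫ s, (T s - halfSign s) ^ 2 ∂unitVolume := by
    set h : ℝ → ℝ := fun s =>
      (T s - halfSign s) ^ 2 - (profile a s - halfSign s) ^ 2 - (T s - profile a s) ^ 2
    have ih : Integrable h unitVolume := (iA.sub iP).sub iB
    have ih' : Integrable (fun s => h (1 - s)) unitVolume :=
      (measurePreserving_one_sub_unitVolume.integrable_comp_emb
        (Homeomorph.subLeft (1 : ℝ)).measurableEmbedding).2 ih
    have h0 : 0 ≤ ∫ s, (h s + h (1 - s)) ∂unitVolume := by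
      refine integral_nonneg_of_ae ?_
      filter_upwards [ae_unitVolume_mem, ae_unitVolume_ne_half, hmem, hmem'] with s hs hne m1 m2
      have hs' : 1 - s ∈ Set.Ioo (0 : ℝ) 1 := ⟨by linarith [hs.2], by linarith [hs.1]⟩
      refine sq_add_sq_le_of_slope hne ?_
      rcases lt_or_gt_of_ne hne with hlt | hgt
      · have := sub_le_of_hausdorff_restrict_le he hconn hle hmono hT hmap hs hs'
          (by linarith) m1 m2
        rw [show halfSign s = -1 from if_pos hlt]
        linarith
      · have := sub_le_of_hausdorff_restrict_le he hconn hle hmono hT hmap hs' hs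
          (by linarith) m2 m1
        rw [show halfSign s = 1 from if_neg (by linarith)]
        linarith
    rw [integral_add ih ih', integral_one_sub_unitVolume h] at h0
    have e1 : ∫ s, h s ∂unitVolume = ∫ s, (T s - halfSign s) ^ 2 ∂unitVolume - profileCost a -
        ∫ s, (T s - profile a s) ^ 2 ∂unitVolume := by
      rw [profileCost, ← integral_sub iA iP]
      exact integral_sub (iA.sub iP) iB
    linarith
  -- At c = T(1/2), monotonicity gives |T - c| = σ(T - c) with σ the sign of s - 1/2, so the dual
  -- bound equals the monotone coupling cost plus the off-axis term.
  have hcost : ∫ y, (1 + ‖y‖ ^ 2 - 2 * |f y - T (1 / 2)|) ∂ν =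
      ∫ s, (T s - halfSign s) ^ 2 ∂unitVolume + ∫ y, (‖y‖ ^ 2 - f y ^ 2) ∂ν := by
    have i3 : Integrable (fun y => 1 + f y ^ 2 - 2 * |f y - T (1 / 2)|) ν :=
      ((integrable_const 1).add if2).sub ((if1.sub (integrable_const _)).abs.const_mul 2)
    have e1 := (tr (fun x => 1 + x ^ 2 - 2 * |x - T (1 / 2)|) (by fun_prop) i3).2
    have e2 : ∫ s, (1 + T s ^ 2 - 2 * |T s - T (1 / 2)|) ∂unitVolume =
        ∫ s, ((T s - halfSign s) ^ 2 + 2 * T (1 / 2) * halfSign s) ∂unitVolume := by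
      refine integral_congr_ae ?_
      filter_upwards [ae_unitVolume_mem] with s hs
      have hh : (1 / 2 : ℝ) ∈ Set.Ioo (0 : ℝ) 1 := by norm_num
      rcases lt_or_ge s (1 / 2) with hlt | hge
      · rw [show halfSign s = -1 from if_pos hlt,
          abs_of_nonpos (sub_nonpos.2 (hmono hs hh hlt.le))]
        ring
      · rw [show halfSign s = 1 from if_neg (by linarith),
          abs_of_nonneg (sub_nonneg.2 (hmono hh hs hge))]
        ring
    rw [integral_add iA (iσ.const_mul _), integral_const_mul, integral_halfSign, mul_zero,
      add_zero] at e2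
    rw [← e2, e1, ← integral_add i3 iK]
    refine integral_congr_ae (Filter.Eventually.of_forall fun y => ?_)
    ring
  have hB0 : 0 ≤ ∫ s, (T s - profile a s) ^ 2 ∂unitVolume := integral_nonneg fun _ => sq_nonneg _
  have hK0 : 0 ≤ ∫ y, (‖y‖ ^ 2 - f y ^ 2) ∂ν := integral_nonneg hK
  refine ⟨∫ s, (T s - profile a s) ^ 2 ∂unitVolume + ∫ y, (‖y‖ ^ 2 - f y ^ 2) ∂ν,
    add_nonneg hB0 hK0, ?_, fun hD => ?_⟩
  · rw [wasserstein_two_rpow_two]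
    refine le_iInf₂ fun γ hγ => ?_
    refine le_trans (ENNReal.ofReal_le_ofReal ?_)
      (ofReal_integral_le_planCost he hν hγ (T (1 / 2)))
    rw [hcost]
    linarith
  · have z1 : ∫ s, (T s - profile a s) ^ 2 ∂unitVolume = 0 := by linarith
    have z2 : ∫ y, (‖y‖ ^ 2 - f y ^ 2) ∂ν = 0 := by linarith
    rw [integral_eq_zero_iff_of_nonneg (fun _ => sq_nonneg _) iB] at z1
    rw [integral_eq_zero_iff_of_nonneg hK iK] at z2
    have hTp : T =ᵐ[unitVolume] profile a := by
      filter_upwards [z1] with s hs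
      exact sub_eq_zero.1 (pow_eq_zero_iff two_ne_zero |>.1 hs)
    have hid : (fun y => y) =ᵐ[ν] fun y => f y • e := by
      filter_upwards [z2] with y hy
      have h3 : ‖y - f y • e‖ ^ 2 = 0 := (norm_sub_inner_smul_sq he y).trans hy
      exact sub_eq_zero.1 (norm_eq_zero.1 (pow_eq_zero_iff two_ne_zero |>.1 h3))
    have hsm : Measurable fun x : ℝ => x • e := (continuous_id.smul continuous_const).measurable
    calc ν = ν.map fun y => y := Measure.map_id'.symm
      _ = ν.map fun y => f y • e := Measure.map_congr hid
      _ = (ν.map f).map fun x => x • e := (Measure.map_map hsm hfm).symm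
      _ = (unitVolume.map (profile a)).map fun x => x • e := by rw [← hmap, Measure.map_congr hTp]
      _ = _ := Measure.map_map hsm (continuous_profile a).measurable

end LowerBound

/-! ### The length functional. -/

section Length

variable {E : Type*} [NormedAddCommGroup E] [MeasurableSpace E] [BorelSpace E]

theorem unitVolume_eq_restrict_Icc : unitVolume = volume.restrict (Set.Icc 0 1) :=
  Measure.restrict_congr_set Ioo_ae_eq_Icc

theorem support_map_unitVolume {G : ℝ → E} (hG : Continuous G) :
    (unitVolume.map G).support = G '' Set.Icc 0 1 := by
  apply Set.Subset.antisymm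
  · refine Measure.support_subset_of_isClosed (isCompact_Icc.image hG).isClosed ?_
    refine (ae_map_iff hG.measurable.aemeasurable
      (isCompact_Icc.image hG).isClosed.measurableSet).2 ?_
    filter_upwards [ae_unitVolume_mem] with s hs
    exact ⟨s, Set.Ioo_subset_Icc_self hs, rfl⟩
  · have hcl : (unitVolume.map G).support = closure (unitVolume.map G).support :=
      Measure.isClosed_support.closure_eq.symm
    rw [hcl, ← closure_Ioo (zero_ne_one (α := ℝ))]
    refine (image_closure_subset_closure_image hG).trans (closure_mono ?_)
    rintro _ ⟨s, hs, rfl⟩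
    rw [Measure.mem_support_iff_forall]
    intro U hU
    obtain ⟨V, hVU, hV, hsV⟩ := mem_nhds_iff.1 hU
    refine lt_of_lt_of_le ?_ (measure_mono hVU)
    rw [Measure.map_apply hG.measurable hV.measurableSet,
      Measure.restrict_apply (hG.measurable hV.measurableSet)]
    exact ((hV.preimage hG).inter isOpen_Ioo).measure_pos volume ⟨s, hsV, hs⟩

/-- An a-Lipschitz map increases ℋ¹ by a factor at most a, so the part of the curve inside A is
bounded by a times the parameter measure of its preimage. -/
theorem lengthFunctional_map_unitVolume_le {G : ℝ → E} {a : ℝ≥0} (hG : LipschitzWith a G) :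
    lengthFunctional (unitVolume.map G) ≤ a := by
  have hsupp := support_map_unitVolume hG.continuous
  have hconn : IsConnected (unitVolume.map G).support := by
    rw [hsupp]
    exact (isConnected_Icc zero_le_one).image G hG.continuous.continuousOn
  rw [lengthFunctional, if_pos hconn]
  refine iInf₂_le a (Measure.le_iff.2 fun A hA => ?_)
  rw [Measure.restrict_apply hA, hsupp]
  have hsub : A ∩ G '' Set.Icc 0 1 ⊆ G '' (G ⁻¹' A ∩ Set.Icc 0 1) := by
    rintro _ ⟨hx, s, hs, rfl⟩
    exact ⟨s, ⟨hx, hs⟩, rfl⟩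
  calc Measure.hausdorffMeasure 1 (A ∩ G '' Set.Icc 0 1)
      ≤ Measure.hausdorffMeasure 1 (G '' (G ⁻¹' A ∩ Set.Icc 0 1)) := measure_mono hsub
    _ ≤ a * volume (G ⁻¹' A ∩ Set.Icc 0 1) := by
        simpa [hausdorffMeasure_real] using
          hG.hausdorffMeasure_image_le zero_le_one (G ⁻¹' A ∩ Set.Icc 0 1)
    _ = (a • unitVolume.map G) A := by
        rw [Measure.smul_apply, Measure.map_apply hG.continuous.measurable hA,
          unitVolume_eq_restrict_Icc, Measure.restrict_apply (hG.continuous.measurable hA)]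
        rfl

/-- The infimum defining a finite length is attained. -/
theorem isConnected_and_restrict_le_of_lengthFunctional_ne_top {ν : Measure E}
    [IsProbabilityMeasure ν] (h : lengthFunctional ν ≠ ∞) :
    IsConnected ν.support ∧
      (Measure.hausdorffMeasure 1 : Measure E).restrict ν.support ≤
        (lengthFunctional ν).toNNReal • ν := by
  have hconn : IsConnected ν.support := by
    by_contra hc
    exact h (by rw [lengthFunctional, if_neg hc])
  refine ⟨hconn, Measure.le_iff.2 fun A _ => ?_⟩
  rw [Measure.smul_apply]
  change _ ≤ ((lengthFunctional ν).toNNReal : ℝ≥0∞) * ν A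
  rw [ENNReal.coe_toNNReal h]
  -- Slack ε in the constant costs at most ε on A, since ν A ≤ 1.
  refine ENNReal.le_of_forall_pos_le_add fun ε hε _ => ?_
  have hlt : lengthFunctional ν < lengthFunctional ν + ε :=
    ENNReal.lt_add_right h (by exact_mod_cast hε.ne')
  nth_rw 1 [lengthFunctional] at hlt
  rw [if_pos hconn] at hlt
  simp only [iInf_lt_iff] at hlt
  obtain ⟨β, hβ, hβlt⟩ := hlt
  calc (Measure.hausdorffMeasure 1 : Measure E).restrict ν.support A
      ≤ (β • ν) A := hβ A
    _ = β * ν A := rfl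
    _ ≤ (lengthFunctional ν + ε) * ν A := by gcongr
    _ = lengthFunctional ν * ν A + ε * ν A := add_mul _ _ _
    _ ≤ lengthFunctional ν * ν A + ε := by
        gcongr
        exact mul_le_of_le_one_right' prob_le_one

end Length

/-! ### Laws of the profiles. -/

section Profile

variable {E : Type*} [NormedAddCommGroup E] [InnerProductSpace ℝ E]

theorem continuous_profile_smul (e : E) (a : ℝ) : Continuous fun s => profile a s • e :=
  (continuous_profile a).smul continuous_const

theorem lipschitzWith_profile_smul {e : E} (he : ‖e‖ = 1) (a : ℝ≥0) :
    LipschitzWith a fun s => profile a s • e := by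
  refine LipschitzWith.of_dist_le_mul fun x y => ?_
  rw [dist_eq_norm, ← sub_smul, norm_smul, he, mul_one, ← dist_eq_norm]
  exact (lipschitzWith_profile a).dist_le_mul x y

/-- The law of `s ↦ profile a s • e` for `s` uniform on `(0, 1)`. -/
noncomputable def profileMeasure [MeasurableSpace E] (e : E) (a : ℝ) : Measure E :=
  unitVolume.map fun s => profile a s • e

theorem profileMeasure_zero [MeasurableSpace E] (e : E) : profileMeasure e 0 = Measure.dirac 0 := by
  have : (fun s => profile 0 s • e) = fun _ => (0 : E) := by
    ext s
    simp [profile]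
  rw [profileMeasure, this, Measure.map_const, measure_univ, one_smul]

end Profile

/-! ### Comparison of energies. -/

section Energy

variable {E : Type*} [NormedAddCommGroup E] [InnerProductSpace ℝ E] [MeasurableSpace E]
  [BorelSpace E]

theorem profileMeasure_mem_finiteMomentProbability {e : E} (he : ‖e‖ = 1) (a : ℝ) :
    profileMeasure e a ∈ finiteMomentProbability E 2 := by
  have hG := continuous_profile_smul e a
  refine ⟨Measure.isProbabilityMeasure_map hG.measurable.aemeasurable, ?_⟩
  rw [profileMeasure, lintegral_map (by fun_prop) hG.measurable]
  refine lt_of_le_of_lt (lintegral_mono (g := fun _ => 1) fun s => ?_) (by simp)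
  refine ENNReal.rpow_le_one ?_ (by norm_num)
  rw [← ofReal_norm, norm_smul, he, mul_one]
  exact ENNReal.ofReal_le_one.2 (abs_profile_le a s)

theorem map_halfSign_smul_unitVolume (e : E) :
    unitVolume.map (fun s => halfSign s • e) = twoDiracs e := by
  have hsplit : unitVolume =
      volume.restrict (Set.Ioo (0 : ℝ) (1 / 2)) + volume.restrict (Set.Ico (1 / 2 : ℝ) 1) := by
    rw [← Measure.restrict_union _ measurableSet_Ico, Set.Ioo_union_Ico_eq_Ioo] <;> norm_num
    exact Set.disjoint_left.2 fun x hx hx' => not_lt.2 hx'.1 hx.2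
  have hm : Measurable fun s => halfSign s • e :=
    (measurable_halfSign.smul_const e)
  rw [hsplit, Measure.map_add _ _ hm]
  have h1 : (volume.restrict (Set.Ioo (0 : ℝ) (1 / 2))).map (fun s => halfSign s • e) =
      (2⁻¹ : ℝ≥0∞) • Measure.dirac (-e) := by
    rw [Measure.map_congr (g := fun _ => -e), Measure.map_const]
    · congr 1
      simp [ENNReal.ofReal_inv_of_pos]
    · filter_upwards [ae_restrict_mem measurableSet_Ioo] with s hs
      rw [halfSign, if_pos hs.2, neg_one_smul]
  have h2 : (volume.restrict (Set.Ico (1 / 2 : ℝ) 1)).map (fun s => halfSign s • e) =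
      (2⁻¹ : ℝ≥0∞) • Measure.dirac e := by
    rw [Measure.map_congr (g := fun _ => e), Measure.map_const]
    · congr 1
      rw [Measure.restrict_apply_univ, Real.volume_Ico,
        show (1 - 1 / 2 : ℝ) = 2⁻¹ by norm_num, ENNReal.ofReal_inv_of_pos (by norm_num)]
      simp
    · filter_upwards [ae_restrict_mem measurableSet_Ico] with s hs
      rw [halfSign, if_neg (not_lt.2 hs.1), one_smul]
  rw [h1, h2, twoDiracs, smul_add]

variable [SecondCountableTopology E]

/-- Driving both marginals by the same uniform s is an admissible plan of this cost. -/
theorem wasserstein_profileMeasure_le {e : E} (he : ‖e‖ = 1) (a : ℝ) :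
    wasserstein 2 (twoDiracs e) (profileMeasure e a) ^ (2 : ℝ) ≤
      ENNReal.ofReal (profileCost a) := by
  rw [wasserstein_two_rpow_two]
  have hm : Measurable fun s => (halfSign s • e, profile a s • e) :=
    (measurable_halfSign.smul_const e).prodMk (continuous_profile_smul e a).measurable
  have hplan : IsTransportPlan (twoDiracs e) (profileMeasure e a)
      (unitVolume.map fun s => (halfSign s • e, profile a s • e)) := by
    constructor
    · rw [Measure.map_map measurable_fst hm, ← map_halfSign_smul_unitVolume]
      rfl
    · rw [Measure.map_map measurable_snd hm]
      rfl
  refine (iInf₂_le _ hplan).trans ?_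
  have hcost : Measurable fun z : E × E => edist z.1 z.2 ^ (2 : ℝ) := by fun_prop
  rw [lintegral_map hcost hm, profileCost, ofReal_integral_eq_lintegral_ofReal
    (integrable_profile_sub_halfSign_sq a) (Filter.Eventually.of_forall fun _ => sq_nonneg _)]
  refine lintegral_mono fun s => le_of_eq ?_
  rw [edist_rpow_two, ← sub_smul, norm_smul, he, mul_one, Real.norm_eq_abs, sq_abs, sub_sq_comm]

theorem relaxedEnergy_profileMeasure_le {e : E} (he : ‖e‖ = 1) {Λ : ℝ} (hΛ : 0 < Λ) (a : ℝ≥0) :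
    relaxedEnergy 2 Λ (twoDiracs e) (profileMeasure e a) ≤
      ENNReal.ofReal (profileCost a + Λ * a) := by
  rw [relaxedEnergy, ENNReal.ofReal_add (profileCost_nonneg _) (by positivity),
    ENNReal.ofReal_mul hΛ.le, ENNReal.ofReal_coe_nnreal]
  gcongr
  · exact wasserstein_profileMeasure_le he a
  · exact lengthFunctional_map_unitVolume_le (lipschitzWith_profile_smul he a)

/-- Strictness has two sources at finite length: a non-optimal length, by `profileCost_add_lt`, or a
positive deficit at the optimal one. Zero deficit identifies the measure. -/
theorem eq_profileMeasure_or_lt_relaxedEnergy {e : E} (he : ‖e‖ = 1) {Λ : ℝ} (hΛ : 0 < Λ)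
    {ν : Measure E} (hν : ν ∈ finiteMomentProbability E 2) :
    ν = profileMeasure e (optimalLength Λ) ∨
      ENNReal.ofReal (profileCost (optimalLength Λ) + Λ * optimalLength Λ) <
        relaxedEnergy 2 Λ (twoDiracs e) ν := by
  have hprob := hν.1
  by_cases htop : lengthFunctional ν = ∞
  · right
    rw [relaxedEnergy, htop, ENNReal.mul_top (by simpa using hΛ), add_top]
    exact ENNReal.ofReal_lt_top
  obtain ⟨hconn, hle⟩ := isConnected_and_restrict_le_of_lengthFunctional_ne_top htop
  set a := (lengthFunctional ν).toNNReal with ha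
  have hL : lengthFunctional ν = a := (ENNReal.coe_toNNReal htop).symm
  obtain ⟨D, hD0, hD, hDeq⟩ := exists_deficit_le_wasserstein he hν hconn hle
  have hlow : ENNReal.ofReal (profileCost a + D + Λ * a) ≤
      relaxedEnergy 2 Λ (twoDiracs e) ν := by
    rw [relaxedEnergy, hL, ENNReal.ofReal_add (add_nonneg (profileCost_nonneg _) hD0)
      (by positivity), ENNReal.ofReal_mul hΛ.le, ENNReal.ofReal_coe_nnreal]
    gcongr
  by_cases hopt : (a : ℝ) = optimalLength Λ
  · rcases hD0.eq_or_lt with h | h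
    · left
      rw [← hopt]
      exact hDeq h.symm
    · right
      refine lt_of_lt_of_le ?_ hlow
      rw [← hopt]
      have := profileCost_nonneg a
      refine (ENNReal.ofReal_lt_ofReal_iff ?_).2 ?_
      · positivity
      · linarith
  · right
    have hlt := profileCost_add_lt hΛ a.coe_nonneg hopt
    refine lt_of_lt_of_le ?_ hlow
    have h0 := profileCost_nonneg (optimalLength Λ)
    have h1 := mul_nonneg hΛ.le (optimalLength_nonneg Λ)
    exact (ENNReal.ofReal_lt_ofReal_iff (by linarith)).2 (by linarith)

theorem isRelaxedSolution_iff_eq_profileMeasure {e : E} (he : ‖e‖ = 1) {Λ : ℝ} (hΛ : 0 < Λ)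
    (ν : Measure E) :
    IsRelaxedSolution 2 Λ (twoDiracs e) ν ↔ ν = profileMeasure e (optimalLength Λ) := by
  have hup : relaxedEnergy 2 Λ (twoDiracs e) (profileMeasure e (optimalLength Λ)) ≤
      ENNReal.ofReal (profileCost (optimalLength Λ) + Λ * optimalLength Λ) :=
    relaxedEnergy_profileMeasure_le he hΛ ⟨optimalLength Λ, optimalLength_nonneg Λ⟩
  have hmem := profileMeasure_mem_finiteMomentProbability he (optimalLength Λ)
  constructor
  · rintro ⟨h1, h2⟩
    exact (eq_profileMeasure_or_lt_relaxedEnergy he hΛ h1).resolve_right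
      (not_lt.2 ((h2 _ hmem).trans hup))
  · rintro rfl
    refine ⟨hmem, fun μ hμ => ?_⟩
    rcases eq_profileMeasure_or_lt_relaxedEnergy he hΛ hμ with h | h
    · rw [h]
    · exact hup.trans h.le

end Energy

/-! ### Identification with the explicit formula. -/

section Explicit

variable {E : Type*} [NormedAddCommGroup E] [InnerProductSpace ℝ E] [MeasurableSpace E]
  [BorelSpace E]

theorem hausdorffMeasure_restrict_segment {e : E} (he : ‖e‖ = 1) {r : ℝ} (hr : 0 ≤ r) :
    (Measure.hausdorffMeasure 1 : Measure E).restrict (segment ℝ (-(r • e)) (r • e)) =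
      (volume.restrict (Set.Icc (-r) r)).map fun x => x • e := by
  have hiso : Isometry fun x : ℝ => x • e := by
    refine Isometry.of_dist_eq fun x y => ?_
    rw [dist_eq_norm, ← sub_smul, norm_smul, he, mul_one, ← dist_eq_norm]
  have hseg : segment ℝ (-(r • e)) (r • e) = (fun x : ℝ => x • e) '' Set.Icc (-r) r := by
    rw [← segment_eq_Icc (by linarith), ← neg_smul]
    exact (image_segment ℝ (LinearMap.toSpanSingleton ℝ E e).toAffineMap (-r) r).symm
  have hm := hiso.continuous.measurable
  have hmeas : MeasurableSet (segment ℝ (-(r • e)) (r • e)) := by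
    rw [hseg]
    exact (isCompact_Icc.image hiso.continuous).isClosed.measurableSet
  have hpre : (fun x : ℝ => x • e) ⁻¹' segment ℝ (-(r • e)) (r • e) = Set.Icc (-r) r := by
    rw [hseg, hiso.injective.preimage_image]
  rw [← hpre, ← Measure.restrict_map hm hmeas, ← hausdorffMeasure_real,
    hiso.map_hausdorffMeasure (Or.inl zero_le_one), Measure.restrict_restrict hmeas,
    Set.inter_eq_left.2]
  rw [hseg]
  exact Set.image_subset_range _ _

theorem map_affine_restrict_Icc {a : ℝ} (ha : 0 < a) (r : ℝ) :
    (volume.restrict (Set.Icc (1 / 2 - r / a) (1 / 2 + r / a))).map (fun s => a * (s - 1 / 2)) =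
      ENNReal.ofReal (1 / a) • volume.restrict (Set.Icc (-r) r) := by
  have hm : Measurable fun s : ℝ => a * (s - 1 / 2) := by fun_prop
  have hpre : (fun s : ℝ => a * (s - 1 / 2)) ⁻¹' Set.Icc (-r) r =
      Set.Icc (1 / 2 - r / a) (1 / 2 + r / a) := by
    ext s
    have e1 : 1 / 2 - r / a ≤ s ↔ -r ≤ a * (s - 1 / 2) := by
      rw [sub_le_comm, le_div_iff₀ ha]; constructor <;> intro h <;> linarith
    have e2 : s ≤ 1 / 2 + r / a ↔ a * (s - 1 / 2) ≤ r := by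
      rw [← sub_le_iff_le_add', le_div_iff₀ ha]; constructor <;> intro h <;> linarith
    simp only [Set.mem_preimage, Set.mem_Icc, e1, e2]
  have hvol : (volume : Measure ℝ).map (fun s => a * (s - 1 / 2)) =
      ENNReal.ofReal (1 / a) • volume := by
    have : (fun s : ℝ => a * (s - 1 / 2)) = (fun x => a * x) ∘ fun s => s - 1 / 2 := rfl
    rw [this, ← Measure.map_map (by fun_prop) (by fun_prop),
      (measurePreserving_sub_right volume (1 / 2 : ℝ)).map_eq, Real.map_volume_mul_left ha.ne',
      abs_of_pos (by positivity), one_div]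
  rw [← hpre, ← Measure.restrict_map hm measurableSet_Icc, hvol, Measure.restrict_smul]

theorem profileMeasure_of_le_two {e : E} (he : ‖e‖ = 1) {a : ℝ} (ha : 0 < a) (h : a ≤ 2) :
    profileMeasure e a = ENNReal.ofReal (1 / a) •
      (Measure.hausdorffMeasure 1 : Measure E).restrict
        (segment ℝ (-((a / 2) • e)) ((a / 2) • e)) := by
  have hae : (fun s => profile a s • e) =ᵐ[unitVolume] fun s => (a * (s - 1 / 2)) • e := by
    filter_upwards [ae_unitVolume_mem] with s hs
    have h1 : -1 ≤ a * (s - 1 / 2) := by nlinarith [hs.1, hs.2]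
    have h2 : a * (s - 1 / 2) ≤ 1 := by nlinarith [hs.1, hs.2]
    rw [profile, min_eq_right h2, max_eq_right h1]
  have hsm : Measurable fun x : ℝ => x • e := (continuous_id.smul continuous_const).measurable
  have haff := map_affine_restrict_Icc ha (a / 2)
  -- Half-width a/2 is the choice for which the parameter interval is all of [0, 1].
  rw [show 1 / 2 - a / 2 / a = 0 by field_simp; norm_num,
    show 1 / 2 + a / 2 / a = 1 by field_simp; norm_num, ← unitVolume_eq_restrict_Icc] at haff
  rw [profileMeasure, Measure.map_congr hae, hausdorffMeasure_restrict_segment he (by positivity),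
    ← Measure.map_smul, ← haff, Measure.map_map hsm (by fun_prop)]
  rfl

theorem profileMeasure_of_two_le {e : E} (he : ‖e‖ = 1) {a : ℝ} (h : 2 ≤ a) :
    profileMeasure e a = ENNReal.ofReal (1 / a) •
      (Measure.hausdorffMeasure 1 : Measure E).restrict (segment ℝ (-e) e) +
        ENNReal.ofReal (1 / 2 - 1 / a) • (Measure.dirac (-e) + Measure.dirac e) := by
  have ha : 0 < a := by linarith
  have hb : 1 / a ≤ 1 / 2 := one_div_le_one_div_of_le (by norm_num) h
  have hb0 : 0 < 1 / a := by positivity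
  have hab : a * (1 / a) = 1 := by field_simp
  have hsm : Measurable fun x : ℝ => x • e := (continuous_id.smul continuous_const).measurable
  set b := 1 / a with hbdef
  -- The clamp collapses each outer piece, of length 1/2 - 1/a, to an atom at ±e; the middle piece
  -- is stretched onto the segment with density 1/a.
  have hsplit : unitVolume = volume.restrict (Set.Ico 0 (1 / 2 - b)) +
      volume.restrict (Set.Icc (1 / 2 - b) (1 / 2 + b)) +
      volume.restrict (Set.Ioc (1 / 2 + b) 1) := by
    rw [← Measure.restrict_union _ measurableSet_Icc, ← Measure.restrict_union _ measurableSet_Ioc,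
      Set.Ico_union_Icc_eq_Icc (by linarith) (by linarith),
      Set.Icc_union_Ioc_eq_Icc (by linarith) (by linarith), unitVolume_eq_restrict_Icc]
    · refine Set.disjoint_left.2 ?_
      rintro x (hx | hx) hx' <;> linarith [hx.1, hx.2, hx'.1]
    · exact Set.disjoint_left.2 fun x hx hx' => not_lt.2 hx'.1 hx.2
  have hG := (continuous_profile_smul e a).measurable
  rw [profileMeasure, hsplit, Measure.map_add _ _ hG, Measure.map_add _ _ hG]
  have h1 : (volume.restrict (Set.Ico 0 (1 / 2 - b))).map (fun s => profile a s • e) =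
      ENNReal.ofReal (1 / 2 - b) • Measure.dirac (-e) := by
    rw [Measure.map_congr (g := fun _ => -e), Measure.map_const]
    · rw [Measure.restrict_apply_univ, Real.volume_Ico, sub_zero]
    · filter_upwards [ae_restrict_mem measurableSet_Ico] with s hs
      have h3 : a * (s - 1 / 2) ≤ -1 := by nlinarith [hs.1, hs.2]
      rw [profile, min_eq_right (by linarith), max_eq_left h3, neg_one_smul]
  have h2 : (volume.restrict (Set.Ioc (1 / 2 + b) 1)).map (fun s => profile a s • e) =
      ENNReal.ofReal (1 / 2 - b) • Measure.dirac e := by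
    rw [Measure.map_congr (g := fun _ => e), Measure.map_const]
    · rw [Measure.restrict_apply_univ, Real.volume_Ioc]
      congr 2
      ring
    · filter_upwards [ae_restrict_mem measurableSet_Ioc] with s hs
      have h3 : 1 ≤ a * (s - 1 / 2) := by nlinarith [hs.1, hs.2]
      rw [profile, min_eq_left h3, max_eq_right (by norm_num), one_smul]
  have h3 : (volume.restrict (Set.Icc (1 / 2 - b) (1 / 2 + b))).map (fun s => profile a s • e) =
      ENNReal.ofReal b • (Measure.hausdorffMeasure 1 : Measure E).restrict (segment ℝ (-e) e) := by
    have hseg := hausdorffMeasure_restrict_segment he zero_le_one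
    rw [one_smul] at hseg
    rw [hseg, ← Measure.map_smul, hbdef, ← map_affine_restrict_Icc ha 1,
      Measure.map_map hsm (by fun_prop)]
    refine Measure.map_congr ?_
    filter_upwards [ae_restrict_mem measurableSet_Icc] with s hs
    have h3 : -1 ≤ a * (s - 1 / 2) := by nlinarith [hs.1, hs.2]
    have h4 : a * (s - 1 / 2) ≤ 1 := by nlinarith [hs.1, hs.2]
    simp only [profile, Function.comp_apply]
    rw [min_eq_right h4, max_eq_right h3]
  rw [h1, h2, h3, smul_add]
  abel

theorem profileMeasure_optimalLength {e : E} (he : ‖e‖ = 1) {Λ : ℝ} (hΛ : 0 < Λ) :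
    profileMeasure e (optimalLength Λ) = explicitMinimizer e Λ := by
  unfold optimalLength explicitMinimizer
  split_ifs with h1 h2
  · obtain ⟨hr0, hr1⟩ := sqrt_density_bounds hΛ h1
    rw [profileMeasure_of_two_le he (by rw [le_div_iff₀ hr0]; linarith), one_div_one_div]
  · rw [profileMeasure_of_le_two he (by linarith) (by linarith),
      show 3 * (1 - 2 * Λ) / 2 = 3 / 2 * (1 - 2 * Λ) by ring]
  · exact profileMeasure_zero e

end Explicit

theorem proposition4p7 {E : Type*} [NormedAddCommGroup E] [InnerProductSpace ℝ E]
    [FiniteDimensional ℝ E] [MeasurableSpace E] [BorelSpace E]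
    (e : E) (he : ‖e‖ = 1) (Λ : ℝ) (hΛ : 0 < Λ) (ν : Measure E) :
    LengthRelaxation.IsRelaxedSolution 2 Λ (LengthRelaxation.twoDiracs e) ν ↔
      ν = LengthRelaxation.explicitMinimizer e Λ := by
  have : ProperSpace E := FiniteDimensional.proper ℝ E
  rw [← profileMeasure_optimalLength he hΛ]
  exact isRelaxedSolution_iff_eq_profileMeasure he hΛ ν
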